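/- Let $\phi_t:\mathbb R^{p_t}\times\mathbb R^{q_{t-1}}\to\mathbb R^{q_t}$ ($t=1,\dots,\tau$) and $h:\mathbb R^{q_\tau}\to\mathbb R$ be differentiable, fix $x_0\in\mathbb R^{q_0}$, and for $w=(w_1;\dots;w_\tau)$ let $f(w,x_0)=x_\tau$, where $x_t=\phi_t(w_t,x_{t-1})$ for $t=1,\dots,\tau$ (the forward pass). Put $F(w)=h(f(w,x_0))$ and assume that $F$ is bounded below, with $F^*=\inf F$, and that $F$ is $\nu$-weakly convex, i.e. $F+\frac{\nu}{2}\|\cdot\|_2^2$ is convex. Let $\alpha>0$ with $2\alpha\nu\le 1$, $\kappa\ge 0$, $\varepsilon\ge 0$, and an integer $K\ge 1$. For parameters $w^{(k)}$ ($0\le k<K$) let $(v^{*},x^{*},\lambda^{*})=(v^{*(k)},x^{*(k)},\lambda^{*(k)})$ be a solution of the augmented Lagrangian formulation $$\min_{v,x}\ \sup_{\lambda}\ h(x_\tau)+\sum_{t=1}^\tau\lambda_t^\top\big(\phi_t(w_t^{(k)}+v_t,x_{t-1})-x_t\big)+\frac{\kappa}{2}\sum_{t=1}^\tau\|\phi_t(w_t^{(k)}+v_t,x_{t-1})-x_t\|_2^2+\frac1{2\alpha}\sum_{t=1}^\tau\|v_t\|_2^2$$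 with $x_0$ fixed; that is, $(v^*,x^*)$ attains the minimum and $\lambda^*$ attains the supremum and is an associated Lagrange multiplier (the derivative of the augmented Lagrangian in $(v,x)$ vanishes at $(v^*,x^*,\lambda^*)$). For $\lambda_t,x_t,z_t\in\mathbb R^{q_t}$ and $x_{t-1}\in\mathbb R^{q_{t-1}}$ let $$J^{(k)}_t[\lambda_t,x_{t-1},z_t](v_t)=\lambda_t^\top\phi_t(w^{(k)}_t+v_t,x_{t-1})+\frac1{2\alpha}\|v_t\|_2^2+\frac\kappa2\|\phi_t(w^{(k)}_t+v_t,x_{t-1})-z_t\|_2^2 .$$ Assume that $J^{(k)}_t[\lambda^*_t,x^*_{t-1},x^*_t]$ is convex for all $k<K$ and all $t$ (where $x_0^*=x_0$). Let the iterates satisfy $w^{(k+1)}=w^{(k)}+v^{(k)}$ for $k<K$, where, for some vectors $\lambda^{(k)}_t$ (multipliers) and $z^{(k)}_t$ (targets) and with $x^{(k)}$ the states of the forward pass at $w^{(k)}$, $v^{(k)}_t$ is a minimizer of $J^{(k)}_t[\lambda^{(k)}_t,x^{(k)}_{t-1},z^{(k)}_t]$. (a) If for all $k<K$ and all $t$ one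 has $\|v^{(k)}_t-\hat v_t\|_2\le\alpha\varepsilon$ whenever $\hat v_t$ minimizes $J^{(k)}_t[\lambda^*_t,x^*_{t-1},x^*_t]$, then there are $i\in\{0,\dots,K-1\}$ and $w^\star$ such that $$\|w^{(i)}-w^\star\|_2^2\le\frac{8\alpha}{5K}\big(F(w^{(0)})-F^*\big)+8\alpha^2\tau\varepsilon^2,\qquad \|\nabla F(w^\star)\|_2^2\le\frac{8}{5\alpha K}\big(F(w^{(0)})-F^*\big)+8\tau\varepsilon^2 .$$ (b) If for all $k<K$ one has $\|v^{(k)}-\hat v\|_2\le\alpha\varepsilon$ for the concatenated vectors $\hat v=(\hat v_1;\dots;\hat v_\tau)$ of such minimizers, then there are $i\in\{0,\dots,K-1\}$ and $w^\star$ such that $$\|w^{(i)}-w^\star\|_2^2\le\frac{8\alpha}{5K}\big(F(w^{(0)})-F^*\big)+8\alpha^2\varepsilon^2,\qquad \|\nabla F(w^\star)\|_2^2\le\frac{8}{5\alpha K}\big(F(w^{(0)})-F^*\big)+8\varepsilon^2 .$$ -/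

import Mathlib

noncomputable section

/-- Parameters `w = (w_1; …; w_τ)` (also used for the increments `v`), where `w_t ∈ ℝ^{p_t}`,
with the Euclidean norm of the concatenated vector. -/
abbrev Params {τ : ℕ} (p : Fin τ → ℕ) : Type :=
  PiLp 2 (fun t : Fin τ => EuclideanSpace ℝ (Fin (p t)))

/-- Families `(y_1; …; y_τ)` with `y_t ∈ ℝ^{q_t}`: states, costates (multipliers) or targets.
The layer `t : Fin τ` has input dimension `q t.castSucc` and output dimension `q t.succ`. -/
abbrev States {τ : ℕ} (q : Fin (τ + 1) → ℕ) : Type :=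
  PiLp 2 (fun t : Fin τ => EuclideanSpace ℝ (Fin (q t.succ)))

/-- The layers `φ_t : ℝ^{p_t} × ℝ^{q_{t-1}} → ℝ^{q_t}`. -/
abbrev Layers {τ : ℕ} (p : Fin τ → ℕ) (q : Fin (τ + 1) → ℕ) : Type :=
  (t : Fin τ) → EuclideanSpace ℝ (Fin (p t)) → EuclideanSpace ℝ (Fin (q t.castSucc)) →
    EuclideanSpace ℝ (Fin (q t.succ))

/-- Forward pass: `x_0` is given and `x_t = φ_t(w_t, x_{t-1})`. -/
def forwardPass {τ : ℕ} {p : Fin τ → ℕ} {q : Fin (τ + 1) → ℕ} (φ : Layers p q)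
    (x₀ : EuclideanSpace ℝ (Fin (q 0))) (w : Params p) (s : Fin (τ + 1)) :
    EuclideanSpace ℝ (Fin (q s)) :=
  Fin.induction (motive := fun s => EuclideanSpace ℝ (Fin (q s))) x₀
    (fun t x => φ t (w t) x) s

/-- The chain of computations `f(w, x_0) = x_τ`. -/
def chain {τ : ℕ} {p : Fin τ → ℕ} {q : Fin (τ + 1) → ℕ} (φ : Layers p q)
    (x₀ : EuclideanSpace ℝ (Fin (q 0))) (w : Params p) :
    EuclideanSpace ℝ (Fin (q (Fin.last τ))) :=
  forwardPass φ x₀ w (Fin.last τ)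

/-- The objective `w ↦ h(f(w, x_0))`. -/
def chainObjective {τ : ℕ} {p : Fin τ → ℕ} {q : Fin (τ + 1) → ℕ} (φ : Layers p q)
    (h : EuclideanSpace ℝ (Fin (q (Fin.last τ))) → ℝ)
    (x₀ : EuclideanSpace ℝ (Fin (q 0))) (w : Params p) : ℝ :=
  h (chain φ x₀ w)

/-- `(x_0, x_1, …, x_τ)` from `x_0` and free variables `x_1, …, x_τ`. -/
def withInput {τ : ℕ} {q : Fin (τ + 1) → ℕ} (x₀ : EuclideanSpace ℝ (Fin (q 0)))
    (x : States q) (s : Fin (τ + 1)) : EuclideanSpace ℝ (Fin (q s)) :=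
  Fin.cons (α := fun s => EuclideanSpace ℝ (Fin (q s))) x₀ (fun t => x t) s

/-- `F` is `ν`-weakly convex: `F + (ν/2)‖·‖²` is convex. -/
def IsWeaklyConvex {E : Type*} [NormedAddCommGroup E] [NormedSpace ℝ E] (ν : ℝ) (F : E → ℝ) :
    Prop :=
  ConvexOn ℝ Set.univ (fun x => F x + ν / 2 * ‖x‖ ^ 2)

/-- Augmented Lagrangian of `min_{v, x} h(x_τ) + (1/(2α)) ∑ ‖v_t‖²` subject to
`x_t = φ_t(w_t + v_t, x_{t-1})`. -/
def augLagrangian {τ : ℕ} {p : Fin τ → ℕ} {q : Fin (τ + 1) → ℕ} (φ : Layers p q)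
    (h : EuclideanSpace ℝ (Fin (q (Fin.last τ))) → ℝ)
    (x₀ : EuclideanSpace ℝ (Fin (q 0))) (α κ : ℝ) (w : Params p)
    (v : Params p) (x : States q) (l : States q) : ℝ :=
  h (withInput x₀ x (Fin.last τ))
    + ∑ t, inner ℝ (l t) (φ t (w t + v t) (withInput x₀ x t.castSucc) - x t)
    + κ / 2 * ∑ t, ‖φ t (w t + v t) (withInput x₀ x t.castSucc) - x t‖ ^ 2
    + 1 / (2 * α) * ∑ t, ‖v t‖ ^ 2

/-- `(v, x, l)` solves `min_{v, x} sup_l` of the augmented Lagrangian, `l` being a Lagrange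
multiplier associated with the solution `(v, x)`. -/
structure IsAugLagSolution {τ : ℕ} {p : Fin τ → ℕ} {q : Fin (τ + 1) → ℕ} (φ : Layers p q)
    (h : EuclideanSpace ℝ (Fin (q (Fin.last τ))) → ℝ)
    (x₀ : EuclideanSpace ℝ (Fin (q 0))) (α κ : ℝ) (w : Params p)
    (v : Params p) (x : States q) (l : States q) : Prop where
  /-- `(v, x)` attains the outer minimum. -/
  primal_optimal : ∀ (v' : Params p) (x' : States q),
    (⨆ l' : States q, ((augLagrangian φ h x₀ α κ w v x l' : ℝ) : EReal)) ≤
      ⨆ l' : States q, ((augLagrangian φ h x₀ α κ w v' x' l' : ℝ) : EReal)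
  /-- `l` attains the inner supremum. -/
  dual_attained : ∀ l' : States q,
    augLagrangian φ h x₀ α κ w v x l' ≤ augLagrangian φ h x₀ α κ w v x l
  /-- First-order condition in `(v, x)` (as the inner supremum is attained at every `l` when
  `(v, x)` is feasible, this is what makes `l` a Lagrange multiplier). -/
  stationary : HasFDerivAt
    (fun y : Params p × States q => augLagrangian φ h x₀ α κ w y.1 y.2 l)
    (0 : Params p × States q →L[ℝ] ℝ) (v, x)

/-- The per-layer augmented proximal objective
`v ↦ lᵀ ϕ(w + v, x) + ‖v‖²/(2α) + (κ/2) ‖ϕ(w + v, x) - z‖²`. -/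
def layerObjective {P X Y : Type*} [NormedAddCommGroup P] [NormedAddCommGroup Y]
    [InnerProductSpace ℝ Y] (ϕ : P → X → Y) (α κ : ℝ) (w : P) (l : Y) (x : X) (z : Y) (v : P) :
    ℝ :=
  inner ℝ l (ϕ (w + v) x) + 1 / (2 * α) * ‖v‖ ^ 2 + κ / 2 * ‖ϕ (w + v) x - z‖ ^ 2

end

open Filter Topology

/-! The method is an inexact proximal point method on `F = chainObjective φ h x₀`. A multiplier
attaining the supremum forces feasibility (`feasible`), and on feasible points the augmented
Lagrangian is `F (w + v) + ‖v‖² / (2α)`, so `w k + vs k` is an exact proximal point of `F`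
(`proximal`). Stationarity in each `v_t` and convexity make `vs k t` a minimizer of the layer
objective (`isMinOn_layerObjective`), so the closeness hypotheses bound `‖v k - vs k‖`.

Since `ν ≤ 1 / (2α)`, the proximal objective is strongly convex with quadratic growth `1 / (4α)`.
Telescoping yields a short exact step (`exists_short_proximal_step`). The point `wstar` is the end
of that step, where the gradient of `F` is the displacement divided by `α`. -/

theorem ConvexOn.isMinOn_of_hasFDerivAt_zero {E : Type*} [NormedAddCommGroup E]
    [NormedSpace ℝ E] {f : E → ℝ} {x : E} (hf : ConvexOn ℝ Set.univ f)
    (hx : HasFDerivAt f (0 : E →L[ℝ] ℝ) x) : IsMinOn f Set.univ x := by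
  intro y _
  have hg : ConvexOn ℝ Set.univ (f ∘ AffineMap.lineMap (k := ℝ) x y) := by
    simpa using hf.comp_affineMap (AffineMap.lineMap (k := ℝ) x y)
  have hx' : HasFDerivAt f (0 : E →L[ℝ] ℝ) (AffineMap.lineMap (k := ℝ) x y 0) := by
    simpa using hx
  have hd : HasDerivAt (f ∘ AffineMap.lineMap (k := ℝ) x y) 0 0 := by
    simpa using hx'.comp_hasDerivAt (0 : ℝ) AffineMap.hasDerivAt_lineMap
  have := hg.le_slope_of_hasDerivAt (Set.mem_univ 0) (Set.mem_univ 1) one_pos hd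
  simpa [slope_def_field] using this

/-! ### Inexact proximal point method -/

/-- Quadratic growth of the proximal objective of a weakly convex function around its
minimizer. -/
theorem IsWeaklyConvex.quadratic_growth {E : Type*} [NormedAddCommGroup E]
    [InnerProductSpace ℝ E] {ν α : ℝ} {F : E → ℝ} (hF : IsWeaklyConvex ν F) (hα : 0 < α)
    (hαν : 2 * α * ν ≤ 1) {a y : E}
    (hy : ∀ u, F y + 1 / (2 * α) * ‖y - a‖ ^ 2 ≤ F u + 1 / (2 * α) * ‖u - a‖ ^ 2) (u : E) :
    F y + 1 / (2 * α) * ‖y - a‖ ^ 2 + 1 / (4 * α) * ‖u - y‖ ^ 2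
      ≤ F u + 1 / (2 * α) * ‖u - a‖ ^ 2 := by
  have hν : ν ≤ 1 / (2 * α) := by
    rw [le_div_iff₀ (by positivity)]; linarith
  have hd : 1 / (4 * α) = 1 / (2 * α) / 2 := by field_simp; norm_num
  rw [hd]
  generalize 1 / (2 * α) = c at *
  -- Compare `y` with a point of the segment to `u`, divide by `s`, then let `s → 0`. The
  -- coefficient `c - ν / 2` is at least `c / 2` because `ν ≤ c`.
  have key : ∀ s ∈ Set.Ioo (0 : ℝ) 1,
      F y + c * ‖y - a‖ ^ 2 + (1 - s) * (c / 2 * ‖u - y‖ ^ 2) ≤ F u + c * ‖u - a‖ ^ 2 := by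
    rintro s ⟨hs0, hs1⟩
    have h1 := hF.2 (Set.mem_univ y) (Set.mem_univ u) (sub_pos.2 hs1).le hs0.le (by ring)
    have h2 := hy ((1 - s) • y + s • u)
    have e1 : ‖(1 - s) • y + s • u‖ ^ 2
        = (1 - s) * ‖y‖ ^ 2 + s * ‖u‖ ^ 2 - s * (1 - s) * ‖u - y‖ ^ 2 := by
      rw [norm_add_sq_real, norm_sub_sq_real, norm_smul, norm_smul, inner_smul_left,
        inner_smul_right, mul_pow, mul_pow, Real.norm_eq_abs, Real.norm_eq_abs, sq_abs, sq_abs,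
        real_inner_comm u y]
      simp only [conj_trivial]
      ring
    have e2 : ‖(1 - s) • y + s • u - a‖ ^ 2
        = (1 - s) * ‖y - a‖ ^ 2 + s * ‖u - a‖ ^ 2 - s * (1 - s) * ‖u - y‖ ^ 2 := by
      have : (1 - s) • y + s • u - a = (1 - s) • (y - a) + s • (u - a) := by
        module
      rw [this, norm_add_sq_real, ← sub_sub_sub_cancel_right u y a, norm_sub_sq_real (u - a),
        norm_smul, norm_smul, inner_smul_left,
        inner_smul_right, mul_pow, mul_pow, Real.norm_eq_abs, Real.norm_eq_abs, sq_abs, sq_abs,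
        real_inner_comm (u - a) (y - a)]
      simp only [conj_trivial]
      ring
    simp only [smul_eq_mul] at h1
    rw [e1] at h1
    rw [e2] at h2
    have h3 : 0 ≤ s * (1 - s) * ‖u - y‖ ^ 2 * (c - ν) :=
      mul_nonneg (mul_nonneg (mul_nonneg hs0.le (sub_pos.2 hs1).le) (sq_nonneg _))
        (sub_nonneg.2 hν)
    refine le_of_mul_le_mul_left ?_ hs0
    linarith
  have lim : Tendsto (fun s : ℝ => F y + c * ‖y - a‖ ^ 2 + (1 - s) * (c / 2 * ‖u - y‖ ^ 2))
      (𝓝[>] 0) (𝓝 (F y + c * ‖y - a‖ ^ 2 + (1 - 0) * (c / 2 * ‖u - y‖ ^ 2))) := by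
    refine Continuous.continuousWithinAt ?_
    fun_prop
  rw [sub_zero, one_mul] at lim
  refine le_of_tendsto lim ?_
  filter_upwards [Ioo_mem_nhdsGT one_pos] with s hs using key s hs

/-- Inexact proximal point method on a weakly convex function: some exact proximal step is
short. -/
theorem IsWeaklyConvex.exists_short_proximal_step {E : Type*} [NormedAddCommGroup E]
    [InnerProductSpace ℝ E] {ν α δ : ℝ} {F : E → ℝ} (hF : IsWeaklyConvex ν F) (hα : 0 < α)
    (hαν : 2 * α * ν ≤ 1) (hbdd : BddBelow (Set.range F)) {K : ℕ} (hK : 0 < K) {w y : ℕ → E}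
    (hy : ∀ k < K, ∀ u,
      F (y k) + 1 / (2 * α) * ‖y k - w k‖ ^ 2 ≤ F u + 1 / (2 * α) * ‖u - w k‖ ^ 2)
    (hw : ∀ k < K, ‖w (k + 1) - y k‖ ^ 2 ≤ δ) :
    ∃ i < K, ‖w i - y i‖ ^ 2 ≤ 8 * α / (5 * K) * (F (w 0) - ⨅ u, F u) + 8 * δ := by
  have hδ : 0 ≤ δ := (sq_nonneg _).trans (hw 0 hK)
  -- The values telescope along the exact points `y n`, as nothing controls `F (w (n + 1)) - F (y
  -- n)`. With `‖y n - y (n + 1)‖² ≥ A / 2 - B`, where `A`, `B` are as generalized below, the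
  -- constants are `5/8 = 1/2 + 1/8` and `3/4 = 1/2 + 1/4`. The first step starts at `w 0` itself
  -- and costs no error, hence the factor `n`.
  have sum_le : ∀ n < K, F (y n) + 5 / (8 * α) * ∑ k ∈ Finset.range (n + 1), ‖w k - y k‖ ^ 2
      ≤ F (w 0) + n * (3 / (4 * α) * δ) := by
    intro n
    induction n with
    | zero =>
      intro h0
      have h := hF.quadratic_growth hα hαν (hy 0 h0) (w 0)
      rw [norm_sub_rev (y 0)] at h
      simp only [sub_self, norm_zero] at h
      have : 0 ≤ 1 / (8 * α) * ‖w 0 - y 0‖ ^ 2 := by positivity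
      simp only [zero_add, Finset.range_one, Finset.sum_singleton, Nat.cast_zero, zero_mul]
      have e : 1 / (2 * α) * ‖w 0 - y 0‖ ^ 2 + 1 / (4 * α) * ‖w 0 - y 0‖ ^ 2
        = 5 / (8 * α) * ‖w 0 - y 0‖ ^ 2 + 1 / (8 * α) * ‖w 0 - y 0‖ ^ 2 := by
        field_simp; ring
      linarith
    | succ n ih =>
      intro hn
      have ih := ih (by omega)
      have h := hF.quadratic_growth hα hαν (hy (n + 1) hn) (y n)
      have hδn := hw n (by omega)
      rw [norm_sub_rev (y (n + 1)) (w (n + 1)), norm_sub_rev (y n) (w (n + 1))] at h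
      have tri : ‖w (n + 1) - y (n + 1)‖ ^ 2
          ≤ 2 * (‖w (n + 1) - y n‖ ^ 2 + ‖y n - y (n + 1)‖ ^ 2) := by
        have h1 := norm_sub_le_norm_sub_add_norm_sub (w (n + 1)) (y n) (y (n + 1))
        calc _ ≤ (‖w (n + 1) - y n‖ + ‖y n - y (n + 1)‖) ^ 2 := by gcongr
          _ ≤ _ := add_sq_le
      rw [Finset.sum_range_succ, mul_add]
      push_cast
      generalize ‖w (n + 1) - y (n + 1)‖ ^ 2 = A at *
      generalize ‖w (n + 1) - y n‖ ^ 2 = B at *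
      generalize ‖y n - y (n + 1)‖ ^ 2 = C at *
      have e1 : 1 / (2 * α) = 4 * (1 / (8 * α)) := by field_simp; norm_num
      have e2 : 1 / (4 * α) = 2 * (1 / (8 * α)) := by field_simp; norm_num
      have e3 : 5 / (8 * α) = 5 * (1 / (8 * α)) := by ring
      have e4 : 3 / (4 * α) = 6 * (1 / (8 * α)) := by field_simp; norm_num
      have hc : 0 ≤ 1 / (8 * α) := by positivity
      rw [e1, e2] at h
      rw [e3, e4] at ih ⊢
      generalize 1 / (8 * α) = c at *
      have h1 := mul_le_mul_of_nonneg_left tri hc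
      have h2 := mul_le_mul_of_nonneg_left hδn hc
      linarith
  -- Averaging: if all steps were long, their sum would exceed the bound. The constant `8` leaves
  -- room, since `6/5` would suffice.
  by_contra! hcon
  obtain ⟨n, rfl⟩ : ∃ n, K = n + 1 := ⟨K - 1, by omega⟩
  have hs := sum_le n (by omega)
  have hinf : ⨅ u, F u ≤ F (y n) := ciInf_le hbdd _
  have hlt : ∑ k ∈ Finset.range (n + 1),
      (8 * α / (5 * (n + 1 : ℕ)) * (F (w 0) - ⨅ u, F u) + 8 * δ)
      < ∑ k ∈ Finset.range (n + 1), ‖w k - y k‖ ^ 2 :=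
    Finset.sum_lt_sum_of_nonempty (by simp) fun k hk => hcon k (Finset.mem_range.1 hk)
  rw [Finset.sum_const, Finset.card_range, nsmul_eq_mul] at hlt
  have hc : 0 < 5 / (8 * α) := by positivity
  have h1 := mul_lt_mul_of_pos_left hlt hc
  have e : 5 / (8 * α) * (((n + 1 : ℕ) : ℝ) *
      (8 * α / (5 * (n + 1 : ℕ)) * (F (w 0) - ⨅ u, F u) + 8 * δ))
      = F (w 0) - (⨅ u, F u) + (n + 1) * (5 * (δ / α)) := by
    push_cast
    have : (n : ℝ) + 1 ≠ 0 := by positivity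
    field_simp
  have e' : n * (3 / (4 * α) * δ) = 3 / 4 * (n * (δ / α)) := by
    field_simp
  rw [e] at h1
  rw [e'] at hs
  have : 0 ≤ n * (δ / α) := by positivity
  have : 0 ≤ δ / α := by positivity
  linarith

/-- Fermat's rule for the proximal objective gives `∇F(y) = (a - y) / α`. -/
theorem norm_gradient_sq_of_isProximalPoint {E : Type*} [NormedAddCommGroup E]
    [InnerProductSpace ℝ E] [CompleteSpace E] {α : ℝ} {F : E → ℝ} {a y : E} (hα : 0 < α)
    (hF : DifferentiableAt ℝ F y)
    (hy : ∀ u, F y + 1 / (2 * α) * ‖y - a‖ ^ 2 ≤ F u + 1 / (2 * α) * ‖u - a‖ ^ 2) :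
    ‖gradient F y‖ ^ 2 = ‖a - y‖ ^ 2 / α ^ 2 := by
  have h1 := hF.hasGradientAt.hasFDerivAt
  have h2 : HasFDerivAt (fun u => ‖u - a‖ ^ 2) (2 • innerSL ℝ (y - a)) y :=
    ((hasFDerivAt_id y).sub_const a).norm_sq
  have hmin : IsLocalMin (fun u => F u + 1 / (2 * α) * ‖u - a‖ ^ 2) y :=
    Eventually.of_forall hy
  have h0 := hmin.hasFDerivAt_eq_zero (h1.add (h2.const_mul (1 / (2 * α))))
  have hg : gradient F y = α⁻¹ • (a - y) := by
    refine ext_inner_right ℝ fun z => ?_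
    have := DFunLike.congr_fun h0 z
    simp [inner_sub_left, inner_smul_left] at this ⊢
    field_simp at this ⊢
    linarith
  rw [hg, norm_smul, mul_pow, norm_inv, Real.norm_eq_abs, inv_pow, sq_abs]
  field_simp

/-! ### Forward pass and augmented Lagrangian -/

section
variable {τ : ℕ} {p : Fin τ → ℕ} {q : Fin (τ + 1) → ℕ} {φ : Layers p q}
  {h : EuclideanSpace ℝ (Fin (q (Fin.last τ))) → ℝ} {x₀ : EuclideanSpace ℝ (Fin (q 0))}

theorem forwardPass_succ (w : Params p) (t : Fin τ) :
    forwardPass φ x₀ w t.succ = φ t (w t) (forwardPass φ x₀ w t.castSucc) :=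
  Fin.induction_succ ..

@[simp]
theorem withInput_succ (x : States q) (t : Fin τ) : withInput x₀ x t.succ = x t := rfl

theorem withInput_eq_forwardPass {w : Params p} {x : States q}
    (hx : ∀ t, φ t (w t) (withInput x₀ x t.castSucc) = x t) (s : Fin (τ + 1)) :
    withInput x₀ x s = forwardPass φ x₀ w s := by
  induction s using Fin.induction with
  | zero => rfl
  | succ t ih => rw [forwardPass_succ, ← ih, hx, withInput_succ]

/-- The states of the forward pass satisfy the constraints. -/
theorem exists_feasible_states (φ : Layers p q) (x₀ : EuclideanSpace ℝ (Fin (q 0)))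
    (w : Params p) : ∃ x : States q, ∀ t, φ t (w t) (withInput x₀ x t.castSucc) = x t := by
  let x : States q := WithLp.toLp 2 fun t => forwardPass φ x₀ w t.succ
  have hx : ∀ s, withInput x₀ x s = forwardPass φ x₀ w s := by
    intro s
    cases s using Fin.cases with
    | zero => rfl
    | succ t => rfl
  exact ⟨x, fun t => by rw [hx]; exact (forwardPass_succ w t).symm⟩

theorem differentiable_forwardPass
    (hφ : ∀ t, Differentiable ℝ (fun y : EuclideanSpace ℝ (Fin (p t)) ×
      EuclideanSpace ℝ (Fin (q t.castSucc)) => φ t y.1 y.2)) (s : Fin (τ + 1)) :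
    Differentiable ℝ fun w : Params p => forwardPass φ x₀ w s := by
  induction s using Fin.induction with
  | zero => exact differentiable_const x₀
  | succ t ih =>
    simp only [forwardPass_succ]
    have ht : Differentiable ℝ fun w : Params p => w t :=
      (PiLp.proj 2 (𝕜 := ℝ) (fun t : Fin τ => EuclideanSpace ℝ (Fin (p t))) t).differentiable
    exact (hφ t).comp (ht.prodMk ih)

theorem differentiable_chainObjective
    (hφ : ∀ t, Differentiable ℝ (fun y : EuclideanSpace ℝ (Fin (p t)) ×
      EuclideanSpace ℝ (Fin (q t.castSucc)) => φ t y.1 y.2)) (hh : Differentiable ℝ h) :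
    Differentiable ℝ (chainObjective φ h x₀) :=
  hh.comp (differentiable_forwardPass hφ (Fin.last τ))

theorem augLagrangian_of_feasible {α κ : ℝ} {w v : Params p} {x : States q}
    (hx : ∀ t, φ t (w t + v t) (withInput x₀ x t.castSucc) = x t) (l : States q) :
    augLagrangian φ h x₀ α κ w v x l
      = chainObjective φ h x₀ (w + v) + 1 / (2 * α) * ‖v‖ ^ 2 := by
  have hlast : withInput x₀ x (Fin.last τ) = chain φ x₀ (w + v) :=
    withInput_eq_forwardPass hx _
  simp [augLagrangian, hx, hlast, chainObjective, PiLp.norm_sq_eq_of_L2]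

/-- The dependence of the augmented Lagrangian on a single `v_t` is, up to a constant, given by
the layer objective. -/
theorem augLagrangian_add_single (φ : Layers p q)
    (h : EuclideanSpace ℝ (Fin (q (Fin.last τ))) → ℝ) (x₀ : EuclideanSpace ℝ (Fin (q 0)))
    (α κ : ℝ) (w v : Params p) (x l : States q) (t : Fin τ) : ∃ c : ℝ, ∀ u,
    augLagrangian φ h x₀ α κ w (v + PiLp.single 2 t (u - v t)) x l
      = layerObjective (φ t) α κ (w t) (l t) (withInput x₀ x t.castSucc) (x t) u + c := by
  have split : ∀ g : (s : Fin τ) → EuclideanSpace ℝ (Fin (p s)) → ℝ, ∀ u,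
      ∑ s, g s ((v + PiLp.single 2 t (u - v t) : Params p) s)
        = g t u + ∑ s ∈ Finset.univ.erase t, g s (v s) := by
    intro g u
    rw [← Finset.add_sum_erase _ _ (Finset.mem_univ t)]
    congr 1
    · simp
    · refine Finset.sum_congr rfl fun s hs => ?_
      have hs := Finset.ne_of_mem_erase hs
      simp [hs]
  let r := fun (s : Fin τ) u => φ s (w s + u) (withInput x₀ x s.castSucc) - x s
  refine ⟨h (withInput x₀ x (Fin.last τ)) - inner ℝ (l t) (x t)
    + ∑ s ∈ Finset.univ.erase t, inner ℝ (l s) (r s (v s))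
    + κ / 2 * ∑ s ∈ Finset.univ.erase t, ‖r s (v s)‖ ^ 2
    + 1 / (2 * α) * ∑ s ∈ Finset.univ.erase t, ‖v s‖ ^ 2, fun u => ?_⟩
  rw [augLagrangian, split fun s u => inner ℝ (l s) (r s u), split fun s u => ‖r s u‖ ^ 2,
    split fun s u => ‖u‖ ^ 2, layerObjective]
  simp only [r, inner_sub_right]
  ring

namespace IsAugLagSolution
variable {α κ : ℝ} {w v : Params p} {x l : States q}

/-- Adding the residual `r` to the multiplier raises the Lagrangian by `∑ ‖r s‖²`, so attainment of
the supremum forces `r = 0`. -/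
theorem feasible (hs : IsAugLagSolution φ h x₀ α κ w v x l) (t : Fin τ) :
    φ t (w t + v t) (withInput x₀ x t.castSucc) = x t := by
  let r : States q := WithLp.toLp 2 fun s => φ s (w s + v s) (withInput x₀ x s.castSucc) - x s
  have hd := hs.dual_attained (l + r)
  have e : ∑ s, inner ℝ ((l + r) s) (r s) = ∑ s, inner ℝ (l s) (r s) + ∑ s, ‖r s‖ ^ 2 := by
    simp [inner_add_left, Finset.sum_add_distrib]
  have hle : ∑ s, ‖r s‖ ^ 2 ≤ 0 := by
    change _ + ∑ s, inner ℝ ((l + r) s) (r s) + _ + _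
      ≤ _ + ∑ s, inner ℝ (l s) (r s) + _ + _ at hd
    rw [e] at hd
    linarith
  have hzero := (Finset.sum_eq_zero_iff_of_nonneg fun s _ => sq_nonneg ‖r s‖).1
    (le_antisymm hle (Finset.sum_nonneg fun s _ => sq_nonneg ‖r s‖)) t (Finset.mem_univ t)
  exact sub_eq_zero.1 (norm_eq_zero.1 (pow_eq_zero_iff two_ne_zero |>.1 hzero))

/-- The increment of a solution of the augmented Lagrangian formulation is an exact proximal
step. -/
theorem proximal (hs : IsAugLagSolution φ h x₀ α κ w v x l) (u : Params p) :
    chainObjective φ h x₀ (w + v) + 1 / (2 * α) * ‖(w + v) - w‖ ^ 2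
      ≤ chainObjective φ h x₀ u + 1 / (2 * α) * ‖u - w‖ ^ 2 := by
  obtain ⟨x', hx'⟩ := exists_feasible_states φ x₀ u
  have hx'' : ∀ t, φ t (w t + (u - w) t) (withInput x₀ x' t.castSucc) = x' t := by
    intro t
    simpa using hx' t
  -- Both points are feasible, so each supremum is over a function constant in the multiplier.
  have hp := hs.primal_optimal (u - w) x'
  simp only [augLagrangian_of_feasible hs.feasible, augLagrangian_of_feasible hx'',
    ciSup_const, EReal.coe_le_coe_iff, add_sub_cancel] at hp
  simpa using hp

theorem isMinOn_layerObjective (hs : IsAugLagSolution φ h x₀ α κ w v x l) (t : Fin τ)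
    (hconv : ConvexOn ℝ Set.univ
      (layerObjective (φ t) α κ (w t) (l t) (withInput x₀ x t.castSucc) (x t))) :
    IsMinOn (layerObjective (φ t) α κ (w t) (l t) (withInput x₀ x t.castSucc) (x t))
      Set.univ (v t) := by
  refine hconv.isMinOn_of_hasFDerivAt_zero ?_
  obtain ⟨c, hc⟩ := augLagrangian_add_single φ h x₀ α κ w v x l t
  -- Vary the `t`-th increment alone; by the chain rule the layer objective inherits the zero
  -- derivative.
  let m : EuclideanSpace ℝ (Fin (p t)) → Params p × States q :=
    fun u => (v + PiLp.single 2 t (u - v t), x)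
  have hm : DifferentiableAt ℝ m (v t) := by
    refine DifferentiableAt.prodMk (DifferentiableAt.const_add _ ?_)
      (differentiableAt_const _)
    refine differentiableAt_piLp 2 |>.2 fun s => ?_
    rcases eq_or_ne s t with rfl | hst
    · simp
    · simp [hst]
  have hmv : m (v t) = (v, x) := by
    have : PiLp.single 2 t (0 : EuclideanSpace ℝ (Fin (p t))) = (0 : Params p) :=
      (PiLp.single_eq_zero_iff 2 t).2 rfl
    simp only [m, sub_self, this, add_zero]
  have hst := hs.stationary
  rw [← hmv] at hst
  have hcomp := hst.comp (v t) hm.hasFDerivAt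
  rw [ContinuousLinearMap.zero_comp] at hcomp
  have := hcomp.sub_const c
  refine this.congr_of_eventuallyEq (Eventually.of_forall fun u => ?_)
  simp [m, hc]

end IsAugLagSolution

end

theorem mainTheorem8 (τ : ℕ) (p : Fin τ → ℕ) (q : Fin (τ + 1) → ℕ) (φ : Layers p q)
    (h : EuclideanSpace ℝ (Fin (q (Fin.last τ))) → ℝ)
    (x₀ : EuclideanSpace ℝ (Fin (q 0)))
    -- the standing assumption: the layers and the objective are differentiable
    (hφ : ∀ t, Differentiable ℝ (fun y : EuclideanSpace ℝ (Fin (p t)) ×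
      EuclideanSpace ℝ (Fin (q t.castSucc)) => φ t y.1 y.2))
    (hh : Differentiable ℝ h)
    (α κ ν ε : ℝ) (hα : 0 < α) (hκ : 0 ≤ κ) (hε : 0 ≤ ε)
    (hweak : IsWeaklyConvex ν (chainObjective φ h x₀)) (hαν : 2 * α * ν ≤ 1)
    (hbdd : BddBelow (Set.range (chainObjective φ h x₀)))
    (K : ℕ) (hK : 0 < K)
    -- iterates `w k`, increments `v k`, computed multipliers `l k` and targets `z k`
    (w v : ℕ → Params p) (l z : ℕ → States q)
    -- solutions of the augmented Lagrangian formulation at each iteration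
    (vs : ℕ → Params p) (xs ls : ℕ → States q)
    (hsol : ∀ k < K, IsAugLagSolution φ h x₀ α κ (w k) (vs k) (xs k) (ls k))
    -- the subproblems defined by the optimal multipliers and states are convex
    (hconv : ∀ k < K, ∀ t, ConvexOn ℝ Set.univ
      (layerObjective (φ t) α κ (w k t) (ls k t) (withInput x₀ (xs k) t.castSucc) (xs k t)))
    -- the method: per-layer argmin with the states of the forward pass, then the update
    (hv : ∀ k < K, ∀ t, IsMinOn
      (layerObjective (φ t) α κ (w k t) (l k t) (forwardPass φ x₀ (w k) t.castSucc) (z k t))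
      Set.univ (v k t))
    (hw : ∀ k < K, w (k + 1) = w k + v k) :
    -- each layer update is `αε`-close to the one defined by the optimal multipliers and states
    ((∀ k < K, ∀ t, ∀ u, IsMinOn
        (layerObjective (φ t) α κ (w k t) (ls k t) (withInput x₀ (xs k) t.castSucc) (xs k t))
        Set.univ u → ‖v k t - u‖ ≤ α * ε) →
      ∃ i < K, ∃ wstar : Params p,
        ‖w i - wstar‖ ^ 2 ≤ 8 * α / (5 * K) *
          (chainObjective φ h x₀ (w 0) - ⨅ w', chainObjective φ h x₀ w')
            + 8 * α ^ 2 * (τ * ε ^ 2) ∧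
        ‖gradient (chainObjective φ h x₀) wstar‖ ^ 2 ≤ 8 / (5 * α * K) *
          (chainObjective φ h x₀ (w 0) - ⨅ w', chainObjective φ h x₀ w')
            + 8 * (τ * ε ^ 2)) ∧
    -- the concatenated update is `αε`-close to the one defined by the optimal ones
    ((∀ k < K, ∀ u : Params p, (∀ t, IsMinOn
        (layerObjective (φ t) α κ (w k t) (ls k t) (withInput x₀ (xs k) t.castSucc) (xs k t))
        Set.univ (u t)) → ‖v k - u‖ ≤ α * ε) →
      ∃ i < K, ∃ wstar : Params p,
        ‖w i - wstar‖ ^ 2 ≤ 8 * α / (5 * K) *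
          (chainObjective φ h x₀ (w 0) - ⨅ w', chainObjective φ h x₀ w')
            + 8 * α ^ 2 * ε ^ 2 ∧
        ‖gradient (chainObjective φ h x₀) wstar‖ ^ 2 ≤ 8 / (5 * α * K) *
          (chainObjective φ h x₀ (w 0) - ⨅ w', chainObjective φ h x₀ w')
            + 8 * ε ^ 2) := by
  -- Both parts are instances: `δ = τ * ε ^ 2` for (a), from summing over layers, and `δ = ε ^ 2`
  -- for (b).
  have main : ∀ δ : ℝ, (∀ k < K, ‖v k - vs k‖ ^ 2 ≤ α ^ 2 * δ) →
      ∃ i < K, ∃ wstar : Params p,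
        ‖w i - wstar‖ ^ 2 ≤ 8 * α / (5 * K) *
          (chainObjective φ h x₀ (w 0) - ⨅ w', chainObjective φ h x₀ w') + 8 * α ^ 2 * δ ∧
        ‖gradient (chainObjective φ h x₀) wstar‖ ^ 2 ≤ 8 / (5 * α * K) *
          (chainObjective φ h x₀ (w 0) - ⨅ w', chainObjective φ h x₀ w') + 8 * δ := by
    intro δ hδ
    obtain ⟨i, hi, hshort⟩ := hweak.exists_short_proximal_step hα hαν hbdd hK
      (y := fun k => w k + vs k) (fun k hk => (hsol k hk).proximal) (δ := α ^ 2 * δ)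
      fun k hk => by simpa [hw k hk] using hδ k hk
    rw [← mul_assoc] at hshort
    refine ⟨i, hi, w i + vs i, hshort, ?_⟩
    rw [norm_gradient_sq_of_isProximalPoint hα (differentiable_chainObjective hφ hh _)
      (hsol i hi).proximal, div_le_iff₀ (by positivity)]
    refine hshort.trans_eq ?_
    have : (K : ℝ) ≠ 0 := by positivity
    field_simp
  have hmin := fun k hk t => (hsol k hk).isMinOn_layerObjective t (hconv k hk t)
  refine ⟨fun H => main _ fun k hk => ?_, fun H => main _ fun k hk => ?_⟩
  · calc ‖v k - vs k‖ ^ 2 = ∑ t, ‖v k t - vs k t‖ ^ 2 := by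
          simp [PiLp.norm_sq_eq_of_L2]
      _ ≤ ∑ _t : Fin τ, (α * ε) ^ 2 := by
          gcongr with t
          exact H k hk t _ (hmin k hk t)
      _ = α ^ 2 * (τ * ε ^ 2) := by
          simp; ring
  · rw [← mul_pow]
    gcongr
    exact H k hk _ (hmin k hk)
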